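/- All graphs are finite, connected, undirected and simple, and $\mathrm{dist}$ denotes the graph distance. A family of (at most) $d$ spanning trees $T_1,\dots,T_d$ of a graph $H$ \emph{collectively $+c$-spans} $H$ if for all vertices $u,v$ of $H$ there is an $i$ with $\mathrm{dist}_{T_i}(u,v)\le \mathrm{dist}_H(u,v)+c$. Let $G$ be a graph with a root $r$ and a set of at least two terminals. A spanning tree $T$ of $G$ is a \emph{Fast Connecting (FC) tree} if $\mathrm{dist}_T(r,t)=\mathrm{dist}_G(r,t)$ for every terminal $t$. For a given $c$, $G$ is a \emph{$d$-gadget} if no $d$ FC trees of $G$ collectively $+c$-span $G$ and, moreover, this is witnessed by terminals: for any FC trees $T_1,\dots,T_d$ of $G$ (not necessarily distinct) there are terminals $s,t$ with $\mathrm{dist}_{T_i}(s,t)>\mathrm{dist}_G(s,t)+c$ for all $i$. The complete tree $H_D(G)$ of copies of $G$ of depth $D\ge 1$, rooted at the root of its root copy of $G$, is defined recursively: $H_1(G)=G$, and $H_{D+1}(G)$ is obtained from one copy of $G$ (the root copy) by attaching, at each terminal $t$ of it, a separate copy of $H_D(G)$ whose root is identified with $t$. \textbf{Theorem (The ``Master''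 Theorem).} Let $c\ge 2$ and $d\ge 2$ be integers. There is a constant $D_0$, depending only on $c$ and $d$, such that for every $d$-gadget $G$ (with respect to $c$) and every $D\ge D_0$, no $d$ spanning trees of $H_D(G)$ collectively $+c$-span $H_D(G)$. -/

import Mathlib

universe u

/-- `T` is a spanning tree of `G`: a subgraph on the full vertex set that is a tree. -/
def IsSpanningTree {V : Type*} (G T : SimpleGraph V) : Prop :=
  T ≤ G ∧ T.IsTree

/-- The family `T` of `d` (not necessarily distinct) graphs collectively `+c`-spans `G`: for every
pair of vertices some member of the family approximates their distance up to an additive `c`. -/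
def CollectivelySpans {V : Type*} {d : ℕ} (c : ℕ) (G : SimpleGraph V)
    (T : Fin d → SimpleGraph V) : Prop :=
  ∀ u v : V, ∃ i : Fin d, (T i).dist u v ≤ G.dist u v + c

/-- A connected graph with a root and a set of at least two terminals. -/
structure RootedTerminalGraph (V : Type*) where
  graph : SimpleGraph V
  connected : graph.Connected
  root : V
  terminals : Finset V
  two_le_card : 2 ≤ terminals.card

/-- A graph (with its vertex type) together with a distinguished root. -/
structure RootedGraph where
  Vert : Type u
  graph : SimpleGraph Vert
  root : Vert

namespace RootedTerminalGraph

/-- Fast Connecting trees: spanning trees that preserve all root-terminal distances. -/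
def IsFCTree {V : Type*} (A : RootedTerminalGraph V) (T : SimpleGraph V) : Prop :=
  IsSpanningTree A.graph T ∧ ∀ t ∈ A.terminals, T.dist A.root t = A.graph.dist A.root t

/-- `d`-gadgets (with respect to the surplus `c`): no `d` FC trees collectively `+c`-span the graph,
and this is always witnessed by a pair of terminals (which may depend on the trees). -/
def IsGadget {V : Type*} (A : RootedTerminalGraph V) (c d : ℕ) : Prop :=
  ∀ T : Fin d → SimpleGraph V, (∀ i, A.IsFCTree (T i)) →
    ∃ s ∈ A.terminals, ∃ t ∈ A.terminals, ∀ i, A.graph.dist s t + c < (T i).dist s t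

/-- Adjacency in the graph obtained from `A` by attaching, at every terminal `t`, a separate copy
of `K` whose root is identified with `t`. The vertices are those of `A` together with, for each
terminal `t`, the non-root vertices of the copy of `K` at `t`. -/
def attachAdj {V : Type u} (A : RootedTerminalGraph V) (K : RootedGraph.{u}) :
    V ⊕ (A.terminals × {x : K.Vert // x ≠ K.root}) →
    V ⊕ (A.terminals × {x : K.Vert // x ≠ K.root}) → Prop
  | .inl a, .inl b => A.graph.Adj a b
  | .inl a, .inr (t, y) => a = t ∧ K.graph.Adj K.root y
  | .inr (s, x), .inl b => b = s ∧ K.graph.Adj x K.root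
  | .inr (s, x), .inr (t, y) => s = t ∧ K.graph.Adj x y

/-- The graph `A` with a copy of `K` glued by its root to every terminal of `A`; its root is the
root of `A`. -/
def attach {V : Type u} (A : RootedTerminalGraph V) (K : RootedGraph.{u}) : RootedGraph.{u} where
  Vert := V ⊕ (A.terminals × {x : K.Vert // x ≠ K.root})
  graph :=
    { Adj := A.attachAdj K
      symm := ⟨by
        rintro (a | ⟨s, x⟩) (b | ⟨t, y⟩) h
        · exact A.graph.adj_symm h
        · exact ⟨h.1, K.graph.adj_symm h.2⟩
        · exact ⟨h.1, K.graph.adj_symm h.2⟩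
        · exact ⟨h.1.symm, K.graph.adj_symm h.2⟩⟩
      loopless := ⟨by
        rintro (a | ⟨s, x⟩) h
        · exact A.graph.irrefl h
        · exact K.graph.irrefl h.2⟩ }
  root := .inl A.root

/-- The complete tree of copies of `A` of depth `D`. Depth `0` is a single vertex, so depth `1` is
a copy of `A` with nothing attached; in depth `D + 1` every terminal of the root copy of `A` is the
root of a tree of copies of depth `D`. -/
def copyTree {V : Type u} (A : RootedTerminalGraph V) : ℕ → RootedGraph.{u}
  | 0 => { Vert := PUnit, graph := ⊥, root := PUnit.unit }
  | D + 1 => A.attach (A.copyTree D)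

/-- Depth `1` is (isomorphic to) the graph `A` itself. -/
theorem copyTree_one {V : Type u} (A : RootedTerminalGraph V) :
    ∃ e : A.graph ≃g (A.copyTree 1).graph, e A.root = (A.copyTree 1).root := by
  refine ⟨⟨Equiv.ofBijective (Sum.inl : V → (A.copyTree 1).Vert)
    ⟨Sum.inl_injective, ?_⟩, ?_⟩, rfl⟩
  · rintro (a | ⟨t, x, hx⟩)
    · exact ⟨a, rfl⟩
    · exact absurd rfl hx
  · intro a b
    exact Iff.rfl

end RootedTerminalGraph

/-! ### Combinatorics of surplus vectors along words. -/

section Surplus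

/-! Copies of the gadget are addressed by words of terminals, and `δ x t i` is the surplus of the
`i`-th tree from the root of copy `x` to its terminal `t`. Copies meet in cut vertices, so surpluses
add up along words. In each copy `x` the gadget property gives terminals `s`, `t` that are bad for
every tree that is FC there. For the end `v` of any word below `s`, some tree `i` serves the pair
`t`, `v`. It has surplus at most `c` from `s` to `v` and is not FC on copy `x`, so one of its
increments there is positive (`exists_isEscaping`). This cannot persist. Consider the vectors
bounded by `c + 1` and dominated by attained surpluses. If all subtrees had the same such vectors, a
maximal one could be raised in some coordinate (`IsEscaping.card_dominated_lt`). So each doubling of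
the depth yields a new vector, but there are only finitely many (`not_isEscaping`). -/

/-- The total increment along a word, where reading the letter `t` after the prefix `x`
contributes `δ x t`. -/
def wordSum {τ : Type*} {d : ℕ} : (List τ → τ → Fin d → ℕ) → List τ → Fin d → ℕ
  | _, [] => 0
  | δ, t :: z => δ [] t + wordSum (fun x => δ (t :: x)) z

theorem wordSum_append {τ : Type*} {d : ℕ} (δ : List τ → τ → Fin d → ℕ) (y z : List τ) :
    wordSum δ (y ++ z) = wordSum δ y + wordSum (fun x => δ (y ++ x)) z := by
  induction y generalizing δ with
  | nil => simp [wordSum]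
  | cons t y ih => simp [wordSum, ih, add_assoc]

/-- After every word `x` of length less than `D` there is a letter `s` such that every continuation
of `x ++ [s]` has a coordinate with increment at most `c` which increases at some letter
after `x`. -/
def IsEscaping {τ : Type*} {d : ℕ} (c D : ℕ) (δ : List τ → τ → Fin d → ℕ) : Prop :=
  ∀ x : List τ, x.length < D → ∃ s : τ, ∀ z : List τ, x.length + 1 + z.length ≤ D →
    ∃ i, wordSum (fun y => δ (x ++ s :: y)) z i ≤ c ∧ ∃ t, 0 < δ x t i

theorem IsEscaping.shift {τ : Type*} {d c D D' : ℕ} {δ : List τ → τ → Fin d → ℕ}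
    (h : IsEscaping c D δ) (x : List τ) (hx : x.length + D' ≤ D) :
    IsEscaping c D' (fun y => δ (x ++ y)) := by
  intro y hy
  obtain ⟨s, hs⟩ := h (x ++ y) (by simp only [List.length_append]; omega)
  refine ⟨s, fun z hz => ?_⟩
  obtain ⟨i, hi, ht⟩ := hs z (by simp only [List.length_append]; omega)
  exact ⟨i, by simpa using hi, ht⟩

theorem IsEscaping.mono {τ : Type*} {d c D D' : ℕ} {δ : List τ → τ → Fin d → ℕ}
    (h : IsEscaping c D δ) (hD : D' ≤ D) : IsEscaping c D' δ :=
  h.shift [] (by simpa using hD)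

open Classical in
/-- The vectors with entries at most `c + 1` that are dominated by the total increment of a word of
length at most `m`. -/
noncomputable def dominated {τ : Type*} {d : ℕ} (c m : ℕ) (δ : List τ → τ → Fin d → ℕ) :
    Finset (Fin d → ℕ) :=
  (Finset.Iic fun _ => c + 1).filter fun w => ∃ z : List τ, z.length ≤ m ∧ w ≤ wordSum δ z

theorem mem_dominated {τ : Type*} {d c m : ℕ} {δ : List τ → τ → Fin d → ℕ} {w : Fin d → ℕ} :
    w ∈ dominated c m δ ↔
      (∀ i, w i ≤ c + 1) ∧ ∃ z : List τ, z.length ≤ m ∧ w ≤ wordSum δ z := by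
  simp [dominated, Pi.le_def]

theorem dominated_shift_subset {τ : Type*} {d c m n : ℕ} {δ : List τ → τ → Fin d → ℕ}
    (x : List τ) (hx : x.length + m ≤ n) :
    dominated c m (fun y => δ (x ++ y)) ⊆ dominated c n δ := by
  intro w hw
  obtain ⟨hb, z, hz, hwz⟩ := mem_dominated.1 hw
  refine mem_dominated.2 ⟨hb, x ++ z, by simp only [List.length_append]; omega, ?_⟩
  rw [wordSum_append]
  exact hwz.trans le_add_self

theorem zero_mem_dominated {τ : Type*} {d c m : ℕ} {δ : List τ → τ → Fin d → ℕ} :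
    (0 : Fin d → ℕ) ∈ dominated c m δ :=
  mem_dominated.2 ⟨fun _ => Nat.zero_le _, [], Nat.zero_le _, fun _ => Nat.zero_le _⟩

/-- If all words of length at most `m + 1` have the same dominated vectors after them, a maximal
such vector can be increased. -/
theorem IsEscaping.card_dominated_lt {τ : Type*} {d c m : ℕ} {δ : List τ → τ → Fin d → ℕ}
    (h : IsEscaping c (2 * m + 1) δ) {n : ℕ}
    (hn : ∀ x : List τ, x.length ≤ m + 1 → n ≤ (dominated c m fun y => δ (x ++ y)).card) :
    n < (dominated c (2 * m + 1) δ).card := by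
  by_contra! hlt
  have heq : ∀ x : List τ, x.length ≤ m + 1 →
      (dominated c m fun y => δ (x ++ y)) = dominated c (2 * m + 1) δ := fun x hx =>
    Finset.eq_of_subset_of_card_le (dominated_shift_subset x (by omega)) (hlt.trans (hn x hx))
  obtain ⟨w, hw⟩ := (dominated c (2 * m + 1) δ).exists_maximal ⟨0, zero_mem_dominated⟩
  -- Reaching `w` within length `m` leaves room for the letter `s` and a second word of length `m`,
  -- whence the depth `2 * m + 1`.
  have hw0 : w ∈ dominated c m δ := by simpa [← heq [] (by simp)] using hw.1
  obtain ⟨hb, x, hx, hwx⟩ := mem_dominated.1 hw0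
  obtain ⟨s, hs⟩ := h x (by omega)
  have hws := hw.1
  -- The same `w` is also dominated below `x ++ [s]`; the escaping coordinate `i` of that word then
  -- forces `w i ≤ c`.
  rw [← heq (x ++ [s]) (by simpa using hx)] at hws
  obtain ⟨-, z, hz, hwz⟩ := mem_dominated.1 hws
  obtain ⟨i, hi, t, ht⟩ := hs z (by omega)
  have hwi : w i ≤ c := (hwz i).trans (by simpa using hi)
  -- The cap `c + 1` leaves room for the raise, which the word `x ++ [t]` realizes.
  have hmem : w + Pi.single i 1 ∈ dominated c (2 * m + 1) δ := by
    refine mem_dominated.2 ⟨fun j => ?_, x ++ [t], by simp; omega, fun j => ?_⟩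
    · rcases eq_or_ne j i with rfl | hj
      · simpa using hwi
      · simpa [hj] using hb j
    · have : w j ≤ wordSum δ x j := hwx j
      rcases eq_or_ne j i with rfl | hj
      · simp [wordSum_append, wordSum]; omega
      · simp [wordSum_append, wordSum, hj]; omega
  have := hw.2 hmem (by simp) i
  simp at this

theorem IsEscaping.lt_card_dominated {τ : Type*} {d c : ℕ} (n : ℕ)
    {δ : List τ → τ → Fin d → ℕ} (h : IsEscaping c (2 ^ n - 1) δ) :
    n < (dominated c (2 ^ n - 1) δ).card := by
  induction n generalizing δ with
  | zero => exact Finset.card_pos.2 ⟨0, zero_mem_dominated⟩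
  | succ n ih =>
    have hpow : 2 ^ (n + 1) - 1 = 2 * (2 ^ n - 1) + 1 := by
      have := Nat.one_le_two_pow (n := n)
      omega
    rw [hpow] at h ⊢
    exact h.card_dominated_lt fun x hx => ih (h.shift x (by omega))

/-- At this depth there would be more dominated vectors than the box `[0, c + 1]^d` contains. -/
theorem not_isEscaping {τ : Type*} {c d D : ℕ} (δ : List τ → τ → Fin d → ℕ)
    (hD : 2 ^ (Finset.Iic fun _ : Fin d => c + 1).card - 1 ≤ D) : ¬ IsEscaping c D δ := by
  classical
  intro h
  exact ((h.mono hD).lt_card_dominated).not_ge (Finset.card_le_card (Finset.filter_subset _ _))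

end Surplus

/-! ### Distance bounds from potentials, retractions and homomorphisms. -/

section Distance

theorem SimpleGraph.Connected.le_add_dist {V : Type*} {G : SimpleGraph V} (hG : G.Connected)
    {f : V → ℕ} (hf : ∀ u v, G.Adj u v → f v ≤ f u + 1) (u v : V) :
    f v ≤ f u + G.dist u v := by
  obtain ⟨p, hp⟩ := hG.exists_walk_length_eq_dist u v
  rw [← hp]
  clear hp
  induction p with
  | nil => simp
  | cons h p ih =>
    have := hf _ _ h
    simp only [SimpleGraph.Walk.length_cons]
    omega

theorem SimpleGraph.Connected.of_retraction {V W : Type*} {G : SimpleGraph V} {H : SimpleGraph W}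
    (hG : G.Connected) (ρ : V → W) (hρ : ρ.Surjective)
    (h : ∀ u v, G.Adj u v → ρ u = ρ v ∨ H.Adj (ρ u) (ρ v)) : H.Connected := by
  have key : ∀ {u v : V}, G.Walk u v → H.Reachable (ρ u) (ρ v) := by
    intro u v p
    induction p with
    | nil => exact .rfl
    | cons huv p ih =>
      rcases h _ _ huv with e | e
      · rwa [e]
      · exact e.reachable.trans ih
  have := hG.nonempty.map ρ
  refine ⟨fun a b => ?_⟩
  obtain ⟨u, rfl⟩ := hρ a
  obtain ⟨v, rfl⟩ := hρ b
  obtain ⟨p⟩ := hG u v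
  exact key p

theorem SimpleGraph.Connected.dist_map_le {V W : Type*} {G : SimpleGraph V} {H : SimpleGraph W}
    (hG : G.Connected) (f : G →g H) (u v : V) : H.dist (f u) (f v) ≤ G.dist u v := by
  obtain ⟨p, hp⟩ := hG.exists_walk_length_eq_dist u v
  rw [← hp, ← p.length_map f]
  exact SimpleGraph.dist_le _

theorem SimpleGraph.Connected.dist_le_dist_add_one {V : Type*} {G : SimpleGraph V}
    (hG : G.Connected) (a : V) {u v : V} (h : G.Adj u v) : G.dist a v ≤ G.dist a u + 1 := by
  simpa [SimpleGraph.dist_eq_one_iff_adj.2 h] using hG.dist_triangle (u := a) (v := u) (w := v)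

theorem IsSpanningTree.dist_le {V : Type*} {G T : SimpleGraph V} (h : IsSpanningTree G T)
    (u v : V) : G.dist u v ≤ T.dist u v :=
  h.2.connected.dist_map_le (SimpleGraph.Hom.ofLE h.1) u v

end Distance

/-! ### Distances and spanning trees in a graph with attached copies. -/

namespace RootedTerminalGraph

variable {V : Type u} (A : RootedTerminalGraph V) (K : RootedGraph.{u})

open Classical in
/-- The embedding of the copy of `K` at the terminal `t`. -/
noncomputable def copyEmb (t : A.terminals) (x : K.Vert) : (A.attach K).Vert :=
  if h : x = K.root then .inl t else .inr (t, ⟨x, h⟩)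

/-- The embedding of the root copy. -/
def baseEmb (a : V) : (A.attach K).Vert := .inl a

/-- The retraction onto the root copy. -/
def collapse : (A.attach K).Vert → V
  | .inl a => a
  | .inr p => p.1

open Classical in
/-- The retraction onto the copy of `K` at the terminal `t`. -/
noncomputable def copyProj (t : A.terminals) : (A.attach K).Vert → K.Vert
  | .inl _ => K.root
  | .inr p => if p.1 = t then p.2 else K.root

variable {A K}

@[simp] theorem copyEmb_root (t : A.terminals) :
    A.copyEmb K t K.root = A.baseEmb K t :=
  dif_pos rfl

theorem copyEmb_of_ne (t : A.terminals) {x : K.Vert} (h : x ≠ K.root) :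
    A.copyEmb K t x = Sum.inr (t, ⟨x, h⟩) :=
  dif_neg h

@[simp] theorem collapse_baseEmb (a : V) : A.collapse K (A.baseEmb K a) = a := rfl

@[simp] theorem collapse_copyEmb (t : A.terminals) (x : K.Vert) :
    A.collapse K (A.copyEmb K t x) = t := by
  rcases eq_or_ne x K.root with rfl | h
  · rw [copyEmb_root, collapse_baseEmb]
  · rw [copyEmb_of_ne t h]
    rfl

@[simp] theorem copyProj_baseEmb (t : A.terminals) (a : V) :
    A.copyProj K t (A.baseEmb K a) = K.root := rfl

@[simp] theorem copyProj_copyEmb_self (t : A.terminals) (x : K.Vert) :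
    A.copyProj K t (A.copyEmb K t x) = x := by
  rcases eq_or_ne x K.root with rfl | h
  · rw [copyEmb_root, copyProj_baseEmb]
  · rw [copyEmb_of_ne t h]
    exact if_pos rfl

theorem copyProj_copyEmb_of_ne {s t : A.terminals} (h : s ≠ t) (x : K.Vert) :
    A.copyProj K t (A.copyEmb K s x) = K.root := by
  rcases eq_or_ne x K.root with rfl | hx
  · rw [copyEmb_root, copyProj_baseEmb]
  · rw [copyEmb_of_ne s hx]
    exact if_neg h

theorem baseEmb_injective : (A.baseEmb K).Injective := Sum.inl_injective

theorem copyEmb_injective (t : A.terminals) : (A.copyEmb K t).Injective :=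
  Function.LeftInverse.injective (copyProj_copyEmb_self t)

theorem comap_baseEmb_attach : (A.attach K).graph.comap (A.baseEmb K) = A.graph := rfl

theorem comap_copyEmb_attach (t : A.terminals) :
    (A.attach K).graph.comap (A.copyEmb K t) = K.graph := by
  ext x y
  rw [SimpleGraph.comap_adj]
  rcases eq_or_ne x K.root with rfl | hx <;> rcases eq_or_ne y K.root with rfl | hy
  · simp
  · rw [copyEmb_root, copyEmb_of_ne t hy]
    exact and_iff_right rfl
  · rw [copyEmb_root, copyEmb_of_ne t hx]
    exact and_iff_right rfl
  · rw [copyEmb_of_ne t hy, copyEmb_of_ne t hx]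
    exact and_iff_right rfl

/-- Every edge of a subgraph of `A.attach K` lies in the root copy or in one of the copies
of `K`. -/
theorem adj_cases {X : SimpleGraph (A.attach K).Vert} (hX : X ≤ (A.attach K).graph)
    {u v : (A.attach K).Vert} (h : X.Adj u v) :
    (∃ a b, u = A.baseEmb K a ∧ v = A.baseEmb K b ∧ (X.comap (A.baseEmb K)).Adj a b) ∨
      ∃ t x y, u = A.copyEmb K t x ∧ v = A.copyEmb K t y ∧
        (X.comap (A.copyEmb K t)).Adj x y := by
  have hr (t : A.terminals) : (Sum.inl (t : V) : (A.attach K).Vert) = A.copyEmb K t K.root :=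
    (copyEmb_root t).symm
  have hn (t : A.terminals) (x : {x : K.Vert // x ≠ K.root}) :
      (Sum.inr (t, x) : (A.attach K).Vert) = A.copyEmb K t x := (copyEmb_of_ne t x.2).symm
  have hadj := hX h
  rcases u with a | ⟨s, x⟩ <;> rcases v with b | ⟨t, y⟩
  · exact .inl ⟨a, b, rfl, rfl, h⟩
  · obtain ⟨rfl, -⟩ : a = t ∧ K.graph.Adj K.root y := hadj
    exact .inr ⟨t, K.root, y, hr t, hn t y, by rwa [SimpleGraph.comap_adj, ← hr, ← hn]⟩
  · obtain ⟨rfl, -⟩ : b = s ∧ K.graph.Adj x K.root := hadj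
    exact .inr ⟨s, x, K.root, hn s x, hr s, by rwa [SimpleGraph.comap_adj, ← hr, ← hn]⟩
  · obtain ⟨rfl, -⟩ : s = t ∧ K.graph.Adj x y := hadj
    exact .inr ⟨s, x, y, hn s x, hn s y, by rwa [SimpleGraph.comap_adj, ← hn, ← hn]⟩

section Connected

variable {X : SimpleGraph (A.attach K).Vert} (hX : X ≤ (A.attach K).graph) (hc : X.Connected)

include hX

theorem collapse_adj {u v : (A.attach K).Vert} (h : X.Adj u v) :
    A.collapse K u = A.collapse K v ∨
      (X.comap (A.baseEmb K)).Adj (A.collapse K u) (A.collapse K v) := by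
  rcases adj_cases hX h with ⟨a, b, rfl, rfl, h⟩ | ⟨t, x, y, rfl, rfl, h⟩
  · exact .inr h
  · simp

theorem copyProj_adj (t : A.terminals) {u v : (A.attach K).Vert} (h : X.Adj u v) :
    A.copyProj K t u = A.copyProj K t v ∨
      (X.comap (A.copyEmb K t)).Adj (A.copyProj K t u) (A.copyProj K t v) := by
  rcases adj_cases hX h with ⟨a, b, rfl, rfl, h⟩ | ⟨s, x, y, rfl, rfl, h⟩
  · simp
  · rcases eq_or_ne s t with rfl | hst
    · simpa using .inr h
    · simp [copyProj_copyEmb_of_ne hst]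

include hc

theorem connected_comap_baseEmb : (X.comap (A.baseEmb K)).Connected :=
  hc.of_retraction (A.collapse K) (fun a => ⟨_, collapse_baseEmb a⟩) fun _ _ h => collapse_adj hX h

theorem connected_comap_copyEmb (t : A.terminals) : (X.comap (A.copyEmb K t)).Connected :=
  hc.of_retraction (A.copyProj K t) (fun x => ⟨_, copyProj_copyEmb_self t x⟩)
    fun _ _ h => copyProj_adj hX t h

theorem dist_copyEmb (t : A.terminals) (x y : K.Vert) :
    X.dist (A.copyEmb K t x) (A.copyEmb K t y) = (X.comap (A.copyEmb K t)).dist x y := by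
  have hct := connected_comap_copyEmb hX hc t
  refine le_antisymm (hct.dist_map_le (SimpleGraph.Hom.comap _ _) x y) ?_
  have := hc.le_add_dist (f := fun v => (X.comap (A.copyEmb K t)).dist x (A.copyProj K t v))
    (fun u v h => ?_) (A.copyEmb K t x) (A.copyEmb K t y)
  · simpa using this
  · rcases copyProj_adj hX t h with e | e
    · simp [e]
    · exact hct.dist_le_dist_add_one x e

/-- The terminal `t` separates its copy from the rest. Used both for the whole graph and for its
spanning trees. -/
theorem dist_baseEmb_copyEmb (a : V) (t : A.terminals) (y : K.Vert) :
    X.dist (A.baseEmb K a) (A.copyEmb K t y) =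
      (X.comap (A.baseEmb K)).dist a t + (X.comap (A.copyEmb K t)).dist K.root y := by
  have hcb := connected_comap_baseEmb hX hc
  apply le_antisymm
  · have h₁ : X.dist (A.baseEmb K a) (A.baseEmb K t) ≤ _ :=
      hcb.dist_map_le (SimpleGraph.Hom.comap _ _) a t
    have h₂ := dist_copyEmb hX hc t K.root y
    rw [copyEmb_root] at h₂
    rw [← h₂]
    exact hc.dist_triangle.trans (by gcongr)
  -- The claimed distance from `a` serves as a potential that grows by at most one along each edge.
  · let f : (A.attach K).Vert → ℕ := Sum.elim (fun b => (X.comap (A.baseEmb K)).dist a b) fun p =>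
      (X.comap (A.baseEmb K)).dist a p.1 + (X.comap (A.copyEmb K p.1)).dist K.root p.2
    have hfb (b : V) : f (A.baseEmb K b) = (X.comap (A.baseEmb K)).dist a b := rfl
    have hfc (s : A.terminals) (x : K.Vert) : f (A.copyEmb K s x) =
        (X.comap (A.baseEmb K)).dist a s + (X.comap (A.copyEmb K s)).dist K.root x := by
      rcases eq_or_ne x K.root with rfl | hx
      · rw [copyEmb_root, hfb, SimpleGraph.dist_self, add_zero]
      · rw [copyEmb_of_ne s hx]
        rfl
    have := hc.le_add_dist (f := f) (fun u v h => ?_) (A.baseEmb K a) (A.copyEmb K t y)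
    · rwa [hfb, hfc, SimpleGraph.dist_self, zero_add] at this
    · rcases adj_cases hX h with ⟨b, b', rfl, rfl, h⟩ | ⟨s, x, y, rfl, rfl, h⟩
      · rw [hfb, hfb]
        exact hcb.dist_le_dist_add_one a h
      · rw [hfc, hfc, add_assoc]
        gcongr
        exact (connected_comap_copyEmb hX hc s).dist_le_dist_add_one _ h

end Connected

theorem isSpanningTree_comap_baseEmb {T : SimpleGraph (A.attach K).Vert}
    (hT : IsSpanningTree (A.attach K).graph T) :
    IsSpanningTree A.graph (T.comap (A.baseEmb K)) :=
  ⟨fun _ _ h => hT.1 h, connected_comap_baseEmb hT.1 hT.2.connected,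
    hT.2.isAcyclic.comap (SimpleGraph.Hom.comap _ _) baseEmb_injective⟩

theorem isSpanningTree_comap_copyEmb {T : SimpleGraph (A.attach K).Vert}
    (hT : IsSpanningTree (A.attach K).graph T) (t : A.terminals) :
    IsSpanningTree K.graph (T.comap (A.copyEmb K t)) :=
  ⟨(show T.comap (A.copyEmb K t) ≤ (A.attach K).graph.comap (A.copyEmb K t) from
      fun _ _ h => hT.1 h).trans_eq (comap_copyEmb_attach t),
    connected_comap_copyEmb hT.1 hT.2.connected t,
    hT.2.isAcyclic.comap (SimpleGraph.Hom.comap _ _) (copyEmb_injective t)⟩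

/-- In a gadget, some pair of terminals is bad for all fast connecting members of a family of
spanning trees. -/
theorem IsGadget.exists_bad_pair {c d : ℕ} (hA : A.IsGadget c d) (T : Fin d → SimpleGraph V) :
    ∃ s ∈ A.terminals, ∃ t ∈ A.terminals, ∀ i, A.IsFCTree (T i) →
      A.graph.dist s t + c < (T i).dist s t := by
  classical
  by_cases h : ∃ j, A.IsFCTree (T j)
  · obtain ⟨j, hj⟩ := h
    -- Non-FC members are replaced by an FC one, so that the gadget property applies.
    obtain ⟨s, hs, t, ht, hst⟩ := hA (fun i => if A.IsFCTree (T i) then T i else T j) fun i => by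
      split_ifs with hi
      exacts [hi, hj]
    exact ⟨s, hs, t, ht, fun i hi => by simpa [hi] using hst i⟩
  · obtain ⟨s, hs⟩ := Finset.card_pos.1 (two_pos.trans_le A.two_le_card)
    exact ⟨s, hs, s, hs, fun i hi => (h ⟨i, hi⟩).elim⟩

/-- The increments of the root distances in spanning trees of `A.copyTree D` form a system indexed
by the words of terminals; it is escaping if `A` is a gadget and the trees collectively
`+c`-span. -/
theorem exists_isEscaping {c d : ℕ} (hA : A.IsGadget c d) (D : ℕ)
    (T : Fin d → SimpleGraph (A.copyTree D).Vert)
    (hT : ∀ i, IsSpanningTree (A.copyTree D).graph (T i))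
    (hspan : CollectivelySpans c (A.copyTree D).graph T) :
    ∃ δ : List A.terminals → A.terminals → Fin d → ℕ,
      -- This clause carries the induction: one vertex `v` realizes the word `z` in all trees
      -- simultaneously.
      (∀ z, z.length ≤ D → ∃ v, ∀ i, (T i).dist (A.copyTree D).root v =
        (A.copyTree D).graph.dist (A.copyTree D).root v + wordSum δ z i) ∧ IsEscaping c D δ := by
  induction D with
  | zero =>
    refine ⟨0, fun z hz => ⟨(A.copyTree 0).root, fun i => ?_⟩, fun x hx => by simp at hx⟩
    simp [List.length_eq_zero_iff.1 (Nat.le_zero.1 hz), wordSum]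
  | succ D ih =>
    let K := A.copyTree D
    let H := (A.attach K).graph
    change Fin d → SimpleGraph (A.attach K).Vert at T
    change ∀ i, IsSpanningTree H (T i) at hT
    change CollectivelySpans c H T at hspan
    have hH (i : Fin d) : H.Connected := (hT i).2.connected.mono (hT i).1
    have hdist (i : Fin d) (a : V) (t : A.terminals) (y : K.Vert) :
        H.dist (A.baseEmb K a) (A.copyEmb K t y) = A.graph.dist a t + K.graph.dist K.root y := by
      rw [dist_baseEmb_copyEmb le_rfl (hH i), comap_copyEmb_attach, comap_baseEmb_attach]
    have hdistT (i : Fin d) := dist_baseEmb_copyEmb (hT i).1 (hT i).2.connected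
    have hB (i : Fin d) := isSpanningTree_comap_baseEmb (hT i)
    have hsub (t : A.terminals) := ih (fun i => (T i).comap (A.copyEmb K t))
      (fun i => isSpanningTree_comap_copyEmb (hT i) t) fun u v => by
        obtain ⟨i, hi⟩ := hspan (A.copyEmb K t u) (A.copyEmb K t v)
        rw [dist_copyEmb (hT i).1 (hT i).2.connected, dist_copyEmb le_rfl (hH i),
          comap_copyEmb_attach] at hi
        exact ⟨i, hi⟩
    choose ε hε hεesc using hsub
    -- The subtraction never truncates, since tree distances dominate graph distances.
    let δ : List A.terminals → A.terminals → Fin d → ℕ := fun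
      | [], t, i => ((T i).comap (A.baseEmb K)).dist A.root t - A.graph.dist A.root t
      | s :: x, t, i => ε s x t i
    refine ⟨δ, fun z hz => ?_, fun x hx => ?_⟩
    · rcases z with _ | ⟨t, z⟩
      · exact ⟨A.baseEmb K A.root, fun i => by
          change (T i).dist (A.baseEmb K A.root) _ = H.dist (A.baseEmb K A.root) _ + 0
          rw [SimpleGraph.dist_self, SimpleGraph.dist_self]⟩
      · obtain ⟨v, hv⟩ := hε t z (by simpa using hz)
        refine ⟨A.copyEmb K t v, fun i => ?_⟩
        change (T i).dist (A.baseEmb K A.root) _ = H.dist (A.baseEmb K A.root) _ +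
          ((((T i).comap (A.baseEmb K)).dist A.root t - A.graph.dist A.root t) +
            wordSum (ε t) z i)
        have h₁ : ((T i).comap (A.copyEmb K t)).dist K.root v =
          K.graph.dist K.root v + wordSum (ε t) z i := hv i
        have h₂ := (hB i).dist_le A.root t
        rw [hdist i, hdistT, h₁]
        omega
    · rcases x with _ | ⟨s, x⟩
      · obtain ⟨s, hs, t, ht, hst⟩ := hA.exists_bad_pair fun i => (T i).comap (A.baseEmb K)
        refine ⟨⟨s, hs⟩, fun z hz => ?_⟩
        obtain ⟨v, hv⟩ := hε ⟨s, hs⟩ z (by simp at hz; omega)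
        -- The path from `t` to `v` passes through `s`, so the budget `c` covers both the surplus
        -- from `t` to `s` and that along `z`.
        obtain ⟨i, hi⟩ := hspan (A.baseEmb K t) (A.copyEmb K ⟨s, hs⟩ v)
        have h₁ : ((T i).comap (A.copyEmb K ⟨s, hs⟩)).dist K.root v =
          K.graph.dist K.root v + wordSum (ε ⟨s, hs⟩) z i := hv i
        have h₂ := (hB i).dist_le t s
        rw [hdist i, hdistT, h₁] at hi
        dsimp only at hi
        refine ⟨i, show wordSum (ε ⟨s, hs⟩) z i ≤ c by omega, ?_⟩
        have hnot : ¬ A.IsFCTree ((T i).comap (A.baseEmb K)) := fun hFC => by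
          have := hst i hFC
          rw [SimpleGraph.dist_comm, SimpleGraph.dist_comm (u := s)] at this
          omega
        by_contra! hzero
        refine hnot ⟨hB i, fun t' ht' => le_antisymm ?_ ((hB i).dist_le _ _)⟩
        have : ((T i).comap (A.baseEmb K)).dist A.root t' - A.graph.dist A.root t' ≤ 0 :=
          hzero ⟨t', ht'⟩
        omega
      · obtain ⟨s', hs'⟩ := hεesc s x (by simpa using hx)
        exact ⟨s', fun z hz => hs' z (by simp at hz; omega)⟩

end RootedTerminalGraph

theorem mainTheorem1 (c d : ℕ) (hc : 2 ≤ c) (hd : 2 ≤ d) :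
    ∃ D₀ : ℕ, ∀ (V : Type u) [Finite V] (A : RootedTerminalGraph V), A.IsGadget c d →
      ∀ D : ℕ, D₀ ≤ D →
        ¬ ∃ T : Fin d → SimpleGraph (A.copyTree D).Vert,
          (∀ i, IsSpanningTree (A.copyTree D).graph (T i)) ∧
            CollectivelySpans c (A.copyTree D).graph T := by
  refine ⟨2 ^ (Finset.Iic fun _ : Fin d => c + 1).card - 1, ?_⟩
  rintro V _ A hA D hD ⟨T, hT, hspan⟩
  obtain ⟨δ, -, hδ⟩ := RootedTerminalGraph.exists_isEscaping hA D T hT hspan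
  exact not_isEscaping δ hD hδ
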